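/- Let $k\ge 1$, let $X=\{x\in\mathbb R^k:\|x\|\le \tfrac12\}$ with the Euclidean distance $d$ and the uniform distribution, and let $\mathcal C_{\mathrm{HS}}$ be the class of all half-spaces $\{x\in X:\langle\omega,x\rangle\ge b\}$, $\omega\in\mathbb R^k$, $b\in\mathbb R$. For $S,\ell\in\mathcal C_{\mathrm{HS}}$ let $\mathrm{err}(S,\ell)$ be the probability that a uniformly random point of $X$ is labeled differently by $S$ and $\ell$. For $\ell\in\mathcal C_{\mathrm{HS}}$ and $x\in X$ let $\mathrm{CE}_{\min}(x)$ be the set of points closest to $x$ in the closure of $\{y\in X:\ell(y)\ne\ell(x)\}$. Let $c>0$ and let $f:\mathbb R^{\ge0}\to\mathbb R^{\ge0}$ be non-decreasing with $f(x)\le x^{1+c}/4$ for all $x$. A probabilistic oracle for $\ell$ (probabilistic approximate minimum distance model, $\mathrm{CE}^{d,f}_{\mathrm{prob}}$) is a measurable family $(D_x)_{x\in X}$ of probability distributions such that, for every $x$, $D_x$ is supported on points $x'$ with $\ell(x')\ne\ell(x)$, and, for some $x_{\min}\in\mathrm{CE}_{\min}(x)$, $\mathbb E_{x'\sim D_x}[d(x',x_{\min})]\le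 f(d(x,x_{\min}))$ whenever $d(x,x_{\min})>0$. In each step an active learner chooses a query $x\in X$ depending on the previously seen labeled pairs, and receives $(x,\ell(x))$ and $(x',\ell(x'))$, where $x'$ is sampled independently from $D_x$; after each number $m\ge0$ of steps it holds a hypothesis in $\mathcal C_{\mathrm{HS}}$. For $\varepsilon\in(0,1]$ let $$\mathcal N_{\mathrm{act}}(\mathcal C_{\mathrm{HS}},\mathrm{CE}^{d,f}_{\mathrm{prob}},\varepsilon)=\inf_{\mathcal A}\ \sup_{\ell,\,D}\ \mathbb E[N_{\mathcal A,\ell,\varepsilon}],$$ where $\mathcal A$ ranges over the active learners, $\ell$ over $\mathcal C_{\mathrm{HS}}$, $D$ over the oracles for $\ell$, and $N_{\mathcal A,\ell,\varepsilon}$ is the least number $m$ of steps after which the hypothesis of $\mathcal A$ has error at most $\varepsilon$ ($\infty$ if there is none). For $g:\mathbb R^{\ge0}\to\mathbb R^{\ge0}$ let $\mathrm{Stop}(g;u,b)=\min\{n\ge0: g^{(n)}(u)\le b\}$, with $g^{(n)}$ the $n$-fold iterate, and $\infty$ if there is no such $n$. Then, for every $\varepsilon\in(0,1]$, $$\mathcal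 N_{\mathrm{act}}(\mathcal C_{\mathrm{HS}},\mathrm{CE}^{d,f}_{\mathrm{prob}},\varepsilon)\ \le\ 8\,\mathrm{Stop}\!\left(\tilde f;\tfrac12,\varepsilon'\right)+8,\qquad \tilde f(x)=3f(2x),\quad \varepsilon'=\left(\frac{\varepsilon}{2^{k-1}}\right)^{1/c}.$$ -/

import Mathlib

open MeasureTheory ProbabilityTheory
open scoped NNReal ENNReal

namespace Contrastive

noncomputable section

/-- The error of the concept `S` with respect to the labeling rule `ℓ`: the probability, under the
reference distribution `U`, of a point that they label differently. A concept is a subset of `X`,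
and the label of `x` under `ℓ` is the truth value of `x ∈ ℓ`. -/
def err {X : Type*} [MeasurableSpace X] (U : Measure X) (S ℓ : Set X) : ℝ :=
  U.real {x | ¬ (x ∈ S ↔ x ∈ ℓ)}

/-- The points whose label under `ℓ` differs from the label of `x`. -/
def oppositeLabel {X : Type*} (ℓ : Set X) (x : X) : Set X :=
  {y | ¬ (y ∈ ℓ ↔ x ∈ ℓ)}

/-- The ideal contrastive examples for `x` (minimum distance model): the points closest to `x`
among all limits of sequences of points whose label differs from that of `x`. -/
def minDistExamples {X : Type*} [MetricSpace X] (ℓ : Set X) (x : X) : Set X :=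
  {x' | x' ∈ closure (oppositeLabel ℓ x) ∧
    ∀ y ∈ closure (oppositeLabel ℓ x), dist x x' ≤ dist x y}

/-- A probabilistic approximate minimum distance oracle for the labeling rule `ℓ`, with noise
function `f`: a (measurable) family of probability distributions `D x`, where `D x` is supported on
points whose label differs from that of `x`, and is in expectation within `f (d (x, xmin))` of some
ideal contrastive example `xmin` of `x`. The second requirement applies at positive distances
only: if `d (x, xmin) = 0` (so `x` itself is a limit of points of the other label) and `f 0 = 0`, no
distribution could satisfy both requirements, and `D x` may then be any distribution on the points
of the other label. -/
structure ProbOracle {X : Type*} [MetricSpace X] [MeasurableSpace X]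
    (f : ℝ≥0 → ℝ≥0) (ℓ : Set X) where
  D : Kernel X X
  isMarkov : IsMarkovKernel D
  label_ne : ∀ x, ∀ᵐ x' ∂(D x), x' ∈ oppositeLabel ℓ x
  expected_dist_le : ∀ x, ∃ xmin ∈ minDistExamples ℓ x, 0 < nndist x xmin →
    ∫⁻ x', edist x' xmin ∂(D x) ≤ (f (nndist x xmin) : ℝ≥0∞)

attribute [instance] ProbOracle.isMarkov

/-- What the learner sees in one step: the labeled primary example `(x, ℓ x)` and the labeled
contrastive example `(x', ℓ x')`. -/
abbrev Obs (X : Type*) : Type _ := (X × Prop) × (X × Prop)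

/-- An active learner for the concept class `C`: after `m` steps it chooses, from the `m` pairs of
labeled examples seen so far, the next point to query and its current hypothesis, which belongs to
`C`. Queries, and the errors of hypotheses, depend measurably on the past. -/
structure ActiveLearner {X : Type*} [MeasurableSpace X] (U : Measure X) (C : Set (Set X)) where
  query : (m : ℕ) → (Fin m → Obs X) → X
  measurable_query : ∀ m, Measurable (query m)
  hyp : (m : ℕ) → (Fin m → Obs X) → Set X
  hyp_mem : ∀ m h, hyp m h ∈ C
  measurable_err_hyp : ∀ m, ∀ ℓ ∈ C, Measurable fun h => err U (hyp m h) ℓ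

/-- The labeled pair made of the primary example `p.1` and the contrastive example `p.2`. -/
def toObs {X : Type*} (ℓ : Set X) (p : X × X) : Obs X :=
  ((p.1, p.1 ∈ ℓ), (p.2, p.2 ∈ ℓ))

theorem measurable_toObs {X : Type*} [MeasurableSpace X] {ℓ : Set X} (hℓ : MeasurableSet ℓ) :
    Measurable (toObs ℓ) := by
  have h : Measurable fun x : X => x ∈ ℓ := measurableSet_setOfPred.1 hℓ
  exact (measurable_fst.prodMk (h.comp measurable_fst)).prodMk
    (measurable_snd.prodMk (h.comp measurable_snd))

/-- The distribution of the two-step oracle's answer to the query `x`, when the labeling rule is `ℓ`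
and contrastive examples are drawn from `D x`. -/
def obsKernel {X : Type*} [MeasurableSpace X] (ℓ : Set X) (D : Kernel X X) : Kernel X (Obs X) :=
  (Kernel.id ×ₖ D).map (toObs ℓ)

theorem isMarkovKernel_obsKernel {X : Type*} [MeasurableSpace X] {ℓ : Set X}
    (hℓ : MeasurableSet ℓ) (D : Kernel X X) [IsMarkovKernel D] :
    IsMarkovKernel (obsKernel ℓ D) :=
  Kernel.IsMarkovKernel.map _ (measurable_toObs hℓ)

/-- Reading off the first `n + 1` steps, numbered `0, …, n`. -/
def history {X : Type*} (n : ℕ) (h : (i : Finset.Iic n) → Obs X) : Fin (n + 1) → Obs X :=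
  fun i => h ⟨i, Finset.mem_Iic.2 (Nat.lt_succ_iff.1 i.2)⟩

theorem measurable_history {X : Type*} [MeasurableSpace X] (n : ℕ) :
    Measurable (history (X := X) n) :=
  measurable_pi_lambda _ fun _ => measurable_pi_apply _

/-- The conditional distribution of step `n + 1` (counting from `0`) given the steps `0, …, n`. -/
def stepKernel {X : Type*} [MeasurableSpace X] {U : Measure X} {C : Set (Set X)}
    (A : ActiveLearner U C) (ℓ : Set X) (D : Kernel X X) (n : ℕ) :
    Kernel ((i : Finset.Iic n) → Obs X) (Obs X) :=
  (obsKernel ℓ D).comap (fun h => A.query (n + 1) (history n h))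
    ((A.measurable_query (n + 1)).comp (measurable_history n))

theorem isMarkovKernel_stepKernel {X : Type*} [MeasurableSpace X] {U : Measure X}
    {C : Set (Set X)} (A : ActiveLearner U C) {ℓ : Set X} (hℓ : MeasurableSet ℓ)
    (D : Kernel X X) [IsMarkovKernel D] (n : ℕ) : IsMarkovKernel (stepKernel A ℓ D n) := by
  have := isMarkovKernel_obsKernel hℓ D
  unfold stepKernel
  infer_instance

/-- The law of the infinite interaction of the learner `A` with the oracle: each step queries the
point chosen by `A` from the past, and draws the contrastive example from `D` independently of the
past given that point. -/
def interactionLaw {X : Type*} [MeasurableSpace X] {U : Measure X} {C : Set (Set X)}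
    (A : ActiveLearner U C) (ℓ : Set X) (hℓ : MeasurableSet ℓ) (D : Kernel X X)
    [IsMarkovKernel D] : Measure (ℕ → Obs X) :=
  have := isMarkovKernel_stepKernel A hℓ D
  Kernel.trajMeasure (X := fun _ => Obs X) (obsKernel ℓ D (A.query 0 Fin.elim0))
    (stepKernel A ℓ D)

/-- The number of steps after which the hypothesis first has error at most `ε` (`⊤` if never). -/
def firstAccurate {X : Type*} [MeasurableSpace X] {U : Measure X} {C : Set (Set X)}
    (A : ActiveLearner U C) (ℓ : Set X) (ε : ℝ) (ω : ℕ → Obs X) : ℕ∞ :=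
  ⨅ (m : ℕ) (_ : err U (A.hyp m fun i => ω i) ℓ ≤ ε), (m : ℕ∞)

/-- The expected sample requirement for accuracy `ε` of active learning of the class `C` under the
probabilistic approximate minimum distance model with noise function `f`: the infimum over active
learners of the worst case, over the labeling rules in `C` and the oracles for them, of the expected
number of steps needed to reach error at most `ε`. -/
def expectedSampleRequirement {X : Type*} [MetricSpace X] [MeasurableSpace X] (U : Measure X)
    (C : Set (Set X)) (hC : ∀ ℓ ∈ C, MeasurableSet ℓ) (f : ℝ≥0 → ℝ≥0) (ε : ℝ) : ℝ≥0∞ :=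
  ⨅ A : ActiveLearner U C, ⨆ ℓ : C, ⨆ O : ProbOracle f (ℓ : Set X),
    ∫⁻ ω, (firstAccurate A ℓ ε ω : ℝ≥0∞) ∂(interactionLaw A ℓ (hC ℓ ℓ.2) O.D)

/-- The number of iterations of `g` needed to bring `u` down to at most `b` (`⊤` if impossible). -/
def iterationsUntil (g : ℝ≥0 → ℝ≥0) (u b : ℝ≥0) : ℕ∞ :=
  ⨅ (n : ℕ) (_ : g^[n] u ≤ b), (n : ℕ∞)

/-- The closed Euclidean ball of radius `1/2` around the origin of `ℝᵏ`. -/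
abbrev Ball (k : ℕ) : Type :=
  Metric.closedBall (0 : EuclideanSpace ℝ (Fin k)) (1 / 2)

/-- The uniform distribution on the ball. -/
def uniformBall (k : ℕ) : Measure (Ball k) :=
  (volume[|Metric.closedBall (0 : EuclideanSpace ℝ (Fin k)) (1 / 2)]).comap Subtype.val

/-- The class of half-spaces over the ball. -/
def halfSpaces (k : ℕ) : Set (Set (Ball k)) :=
  {S | ∃ (w : EuclideanSpace ℝ (Fin k)) (b : ℝ),
    S = {x : Ball k | b ≤ inner ℝ w (x : EuclideanSpace ℝ (Fin k))}}

theorem measurableSet_of_mem_halfSpaces (k : ℕ) :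
    ∀ ℓ ∈ halfSpaces k, MeasurableSet ℓ := by
  rintro _ ⟨w, b, rfl⟩
  exact (isClosed_le (by fun_prop) (by fun_prop)).measurableSet

end

end Contrastive

/-! The learner keeps a point `y` outside the half-space `⟨n, x⟩ ≥ b` (`n` a unit vector) whose
orthogonal projection onto the boundary lies in the ball. That projection is then the unique ideal
contrastive example of `y`. With `d` the distance from `y` to the boundary, Markov's inequality puts
the contrastive example `y'` within `2 f(d)` of the projection with probability at least `1/2`.

When this happens, there are two consequences. The half-space through `y'` with normal `y' - y`
disagrees with the target only inside a slab of half-width `2 f(d) / d`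
(`abs_inner_sub_le_of_disagree`), which has probability at most `2^(k-1) * 4 f(d) / d`
(`uniformBall_slab_le`); for `d ≤ ε'` this is at most `ε`. Also, walking from `y'` towards `y` by
more than `2 f(d)` leaves the half-space again (`inner_stepToward_lt`), so the point reached
replaces `y` and is at most that step length away from the boundary.

Success of the walk is visible: query the new point and look at its label; on failure, query `y`
again. Iterates of `f̃` serve as target distances, so about `Stop` levels are needed, each taking at
most two attempts of two queries on average. A potential function (`potential_drift` with
`lintegral_firstAccurate_automatonLearner_le`) turns this into the bound `4 J + 4` for `J = Stop`.
-/

namespace Contrastive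

noncomputable section

/-! ### Learners with a memory state, and drift bounds for their expected number of steps. -/

/-- The state of a learner with initial state `init` and transition function `upd` after the
observations `h`. -/
def stateAfter {X St : Type*} (init : St) (upd : St → Obs X → St) :
    (m : ℕ) → (Fin m → Obs X) → St
  | 0, _ => init
  | m + 1, h => upd (stateAfter init upd m fun i => h i.castSucc) (h (Fin.last m))

theorem measurable_stateAfter {X St : Type*} [MeasurableSpace X] [MeasurableSpace St] (init : St)
    {upd : St → Obs X → St} (hupd : Measurable fun p : St × Obs X => upd p.1 p.2) (m : ℕ) :
    Measurable (stateAfter init upd m) := by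
  induction m with
  | zero => exact measurable_const
  | succ m ih =>
    exact hupd.comp ((ih.comp (measurable_pi_lambda _ fun _ => measurable_pi_apply _)).prodMk
      (measurable_pi_apply _))

/-- The active learner that remembers a state only. -/
def automatonLearner {X St : Type*} [MeasurableSpace X] [MeasurableSpace St] {U : Measure X}
    {C : Set (Set X)} (init : St) (upd : St → Obs X → St)
    (hupd : Measurable fun p : St × Obs X => upd p.1 p.2) (q : St → X) (hq : Measurable q)
    (H : St → Set X) (hH : ∀ s, H s ∈ C) (herr : ∀ ℓ ∈ C, Measurable fun s => err U (H s) ℓ) :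
    ActiveLearner U C where
  query m h := q (stateAfter init upd m h)
  measurable_query m := hq.comp (measurable_stateAfter init hupd m)
  hyp m h := H (stateAfter init upd m h)
  hyp_mem _ _ := hH _
  measurable_err_hyp m ℓ hℓ := (herr ℓ hℓ).comp (measurable_stateAfter init hupd m)

section Interaction

variable {X : Type*} [MeasurableSpace X] {U : Measure X} {C : Set (Set X)}

instance isProbabilityMeasure_interactionLaw (A : ActiveLearner U C) (ℓ : Set X)
    (hℓ : MeasurableSet ℓ) (D : Kernel X X) [IsMarkovKernel D] :
    IsProbabilityMeasure (interactionLaw A ℓ hℓ D) := by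
  have := isMarkovKernel_stepKernel A hℓ D
  have := isMarkovKernel_obsKernel hℓ D
  unfold interactionLaw
  infer_instance

theorem map_zero_interactionLaw (A : ActiveLearner U C) (ℓ : Set X)
    (hℓ : MeasurableSet ℓ) (D : Kernel X X) [IsMarkovKernel D] :
    (interactionLaw A ℓ hℓ D).map (fun ω => ω 0) = obsKernel ℓ D (A.query 0 Fin.elim0) := by
  have := isMarkovKernel_stepKernel A hℓ D
  have := isMarkovKernel_obsKernel hℓ D
  have h : (fun ω : ℕ → Obs X => ω 0) =
      (MeasurableEquiv.piUnique (fun i : Finset.Iic 0 => Obs X)) ∘ Preorder.frestrictLe 0 := rfl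
  rw [h, ← Measure.map_map (by fun_prop) (by fun_prop), interactionLaw, Kernel.trajMeasure,
    Measure.map_comp _ _ (by fun_prop), Kernel.traj_map_frestrictLe, Kernel.partialTraj_self,
    Measure.id_comp, Measure.map_map (by fun_prop) (by fun_prop)]
  have h' : (MeasurableEquiv.piUnique (fun i : Finset.Iic 0 => Obs X)) ∘
      (MeasurableEquiv.piUnique (fun i : Finset.Iic 0 => Obs X)).symm = id :=
    funext fun x => MeasurableEquiv.apply_symm_apply _ x
  exact (congrArg (fun g => Measure.map g _) h').trans Measure.map_id

/-- The observation of step `m` has, given the past, the law prescribed by the oracle. -/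
theorem lintegral_interactionLaw (A : ActiveLearner U C) (ℓ : Set X)
    (hℓ : MeasurableSet ℓ) (D : Kernel X X) [IsMarkovKernel D] (m : ℕ)
    {G : (Fin m → Obs X) → Obs X → ℝ≥0∞} (hG : Measurable (Function.uncurry G)) :
    ∫⁻ ω, G (fun i => ω i) (ω m) ∂(interactionLaw A ℓ hℓ D) =
      ∫⁻ ω, ∫⁻ o, G (fun i => ω i) o ∂(obsKernel ℓ D (A.query m fun i => ω i))
        ∂(interactionLaw A ℓ hℓ D) := by
  have := isMarkovKernel_stepKernel A hℓ D
  have := isMarkovKernel_obsKernel hℓ D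
  cases m with
  | zero =>
    have h0 : ∀ ω : ℕ → Obs X, (fun i : Fin 0 => ω i) = Fin.elim0 := fun ω =>
      Subsingleton.elim _ _
    simp only [h0, lintegral_const, measure_univ, mul_one]
    rw [← map_zero_interactionLaw A ℓ hℓ D, lintegral_map _ (measurable_pi_apply 0)]
    exact hG.comp (measurable_const.prodMk measurable_id)
  | succ n =>
    have key : (interactionLaw A ℓ hℓ D).map (Preorder.frestrictLe n) ⊗ₘ stepKernel A ℓ D n =
        (interactionLaw A ℓ hℓ D).map (fun x ↦ (Preorder.frestrictLe n x, x (n + 1))) :=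
      Kernel.map_frestrictLe_trajMeasure_compProd_eq_map_trajMeasure
    set F : ((i : Finset.Iic n) → Obs X) × Obs X → ℝ≥0∞ := fun p => G (history n p.1) p.2
    have hF : Measurable F :=
      hG.comp (((measurable_history n).comp measurable_fst).prodMk measurable_snd)
    have h1 : ∫⁻ ω, G (fun i => ω i) (ω (n + 1)) ∂(interactionLaw A ℓ hℓ D) =
        ∫⁻ p, F p ∂((interactionLaw A ℓ hℓ D).map
          (fun x ↦ (Preorder.frestrictLe n x, x (n + 1)))) := by
      rw [lintegral_map hF (by fun_prop)]
      rfl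
    rw [h1, ← key, Measure.lintegral_compProd hF,
      lintegral_map hF.lintegral_kernel_prod_right' (by fun_prop)]
    rfl

/-- Layer-cake form of a hitting time: the summand for `m` is `1` as long as no hypothesis up to
step `m` is accurate. Integrating reduces the expectation to a sum of probabilities. -/
theorem firstAccurate_le_tsum (A : ActiveLearner U C) (ℓ : Set X) (ε : ℝ) (ω : ℕ → Obs X) :
    (firstAccurate A ℓ ε ω : ℝ≥0∞) ≤
      ∑' m : ℕ, {ω : ℕ → Obs X | ∀ i ≤ m, ε < err U (A.hyp i fun j => ω j) ℓ}.indicator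
        (fun _ => (1 : ℝ≥0∞)) ω := by
  classical
  by_cases h : ∃ m, err U (A.hyp m fun i => ω i) ℓ ≤ ε
  · have h1 : firstAccurate A ℓ ε ω ≤ (Nat.find h : ℕ∞) :=
      iInf₂_le (f := fun (m : ℕ) (_ : err U (A.hyp m fun i => ω i) ℓ ≤ ε) => (m : ℕ∞))
        (Nat.find h) (Nat.find_spec h)
    calc (firstAccurate A ℓ ε ω : ℝ≥0∞) ≤ ((Nat.find h : ℕ∞) : ℝ≥0∞) := by exact_mod_cast h1
      _ = ∑ m ∈ Finset.range (Nat.find h), 1 := by simp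
      _ ≤ ∑ m ∈ Finset.range (Nat.find h),
          {ω : ℕ → Obs X | ∀ i ≤ m, ε < err U (A.hyp i fun j => ω j) ℓ}.indicator
            (fun _ => (1 : ℝ≥0∞)) ω := by
        refine Finset.sum_le_sum fun m hm => ?_
        rw [Set.indicator_of_mem]
        intro i hi
        exact not_le.1 (Nat.find_min h (lt_of_le_of_lt hi (Finset.mem_range.1 hm)))
      _ ≤ _ := ENNReal.sum_le_tsum _
  · push Not at h
    have : ∀ m : ℕ, {ω : ℕ → Obs X | ∀ i ≤ m, ε < err U (A.hyp i fun j => ω j) ℓ}.indicator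
        (fun _ => (1 : ℝ≥0∞)) ω = 1 := fun m =>       by
      rw [Set.indicator_of_mem]
      exact fun i _ => h i
    simp [this]

end Interaction

/-- A potential that decreases by at least one in expectation in each step, as long as the
hypothesis is not accurate, bounds the expected number of steps. -/
theorem lintegral_firstAccurate_automatonLearner_le {X St : Type*} [MeasurableSpace X]
    [MeasurableSpace St] {U : Measure X} {C : Set (Set X)} {init : St} {upd : St → Obs X → St}
    {hupd : Measurable fun p : St × Obs X => upd p.1 p.2} {q : St → X} {hq : Measurable q}
    {H : St → Set X} {hH : ∀ s, H s ∈ C} {herr : ∀ ℓ ∈ C, Measurable fun s => err U (H s) ℓ}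
    {ℓ : Set X} (hℓC : ℓ ∈ C) (hℓ : MeasurableSet ℓ) (D : Kernel X X) [IsMarkovKernel D] (ε : ℝ)
    {Φ : St → ℝ≥0∞} (hΦ : Measurable Φ)
    (hdrift : ∀ s, 1 + ∫⁻ o, {s | ε < err U (H s) ℓ}.indicator Φ (upd s o) ∂(obsKernel ℓ D (q s))
      ≤ Φ s) :
    ∫⁻ ω, (firstAccurate (automatonLearner (U := U) (C := C) init upd hupd q hq H hH herr) ℓ ε ω :
      ℝ≥0∞) ∂(interactionLaw (automatonLearner init upd hupd q hq H hH herr) ℓ hℓ D) ≤ Φ init := by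
  set A := automatonLearner (U := U) (C := C) init upd hupd q hq H hH herr with hA
  set μ := interactionLaw A ℓ hℓ D
  set S : (m : ℕ) → (Fin m → Obs X) → St := stateAfter init upd
  have hS : ∀ m, Measurable (S m) := measurable_stateAfter init hupd
  set W : Set St := {s | ε < err U (H s) ℓ}
  have hW : MeasurableSet W := measurableSet_lt measurable_const (herr ℓ hℓC)
  have hres : ∀ m, Measurable fun (ω : ℕ → Obs X) (i : Fin m) => ω i := fun m =>
    measurable_pi_lambda _ fun _ => measurable_pi_apply _
  set B : (m : ℕ) → Set (ℕ → Obs X) := fun m => {ω | ∀ i ≤ m, S i (fun j => ω j) ∈ W}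
  have hB : ∀ m, MeasurableSet (B m) := fun m => by
    have : B m = ⋂ i ≤ m, (fun ω : ℕ → Obs X => S i (fun j => ω j)) ⁻¹' W := by
      ext ω; simp [B]
    rw [this]
    exact MeasurableSet.iInter fun i => MeasurableSet.iInter fun _ =>
      ((hS i).comp (hres i)) hW
  -- The event `B m` as a set of finite histories, the form in which the next observation can be
  -- integrated out.
  set B' : (m : ℕ) → Set (Fin m → Obs X) := fun m =>
    {h | ∀ i (hi : i ≤ m), S i (fun j => h (Fin.castLE hi j)) ∈ W}
  have hB' : ∀ m, MeasurableSet (B' m) := fun m => by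
    have : B' m = ⋂ i, ⋂ (hi : i ≤ m),
        (fun h : Fin m → Obs X => S i (fun j => h (Fin.castLE hi j))) ⁻¹' W := by
      ext ω; simp [B']
    rw [this]
    exact MeasurableSet.iInter fun i => MeasurableSet.iInter fun hi =>
      ((hS i).comp (measurable_pi_lambda _ fun _ => measurable_pi_apply _)) hW
  set u : ℕ → ℝ≥0∞ := fun m => ∫⁻ ω, (B m).indicator (fun ω => Φ (S m fun j => ω j)) ω ∂μ
  -- The expected potential on the still inaccurate paths falls by at least the probability of such
  -- paths; telescoping bounds the sum of these probabilities by the initial potential.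
  have step : ∀ m, μ (B m) + u (m + 1) ≤ u m := by
    intro m
    set G : (Fin m → Obs X) → Obs X → ℝ≥0∞ := fun h o =>
      (B' m).indicator (fun h => W.indicator Φ (upd (S m h) o)) h
    have hG : Measurable (Function.uncurry G) := by
      have : Function.uncurry G = (Prod.fst ⁻¹' B' m).indicator
          (fun p => W.indicator Φ (upd (S m p.1) p.2)) := by
        ext ⟨h, o⟩; rfl
      rw [this]
      refine Measurable.indicator ?_ (measurable_fst (hB' m))
      exact (hΦ.indicator hW).comp (hupd.comp (((hS m).comp measurable_fst).prodMk measurable_snd))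
    have h1 : u (m + 1) ≤ ∫⁻ ω, G (fun i => ω i) (ω m) ∂μ := by
      refine lintegral_mono fun ω => ?_
      by_cases hω : ω ∈ B (m + 1)
      · have h2 : (fun i : Fin m => ω i) ∈ B' m := fun i hi => hω i (hi.trans m.le_succ)
        have h3 : upd (S m fun i => ω i) (ω m) ∈ W := hω (m + 1) le_rfl
        simp only [G]
        rw [Set.indicator_of_mem hω, Set.indicator_of_mem h2, Set.indicator_of_mem h3]
        exact le_rfl
      · rw [Set.indicator_of_notMem hω]
        exact zero_le
    rw [lintegral_interactionLaw A ℓ hℓ D m hG] at h1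
    rw [← lintegral_indicator_one (hB m)]
    calc _ ≤ ∫⁻ ω, (B m).indicator 1 ω ∂μ +
          ∫⁻ ω, ∫⁻ o, G (fun i => ω i) o ∂(obsKernel ℓ D (A.query m fun i => ω i)) ∂μ := by gcongr
      _ = ∫⁻ ω, ((B m).indicator 1 ω +
          ∫⁻ o, G (fun i => ω i) o ∂(obsKernel ℓ D (A.query m fun i => ω i))) ∂μ :=
        (lintegral_add_left (measurable_one.indicator (hB m)) _).symm
      _ ≤ u m := by
        refine lintegral_mono fun ω => ?_
        by_cases hω : ω ∈ B m
        · have h2 : (fun i : Fin m => ω i) ∈ B' m := fun i hi => hω i hi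
          simp only [G]
          rw [Set.indicator_of_mem hω, Set.indicator_of_mem hω]
          simp only [Set.indicator_of_mem h2]
          exact hdrift _
        · have h2 : (fun i : Fin m => ω i) ∉ B' m := fun h => hω fun i hi => h i hi
          simp only [G]
          rw [Set.indicator_of_notMem hω, Set.indicator_of_notMem hω]
          simp [Set.indicator_of_notMem h2]
  have partial_sums : ∀ M, ∑ m ∈ Finset.range M, μ (B m) + u M ≤ u 0 := by
    intro M
    induction M with
    | zero => simp
    | succ M ih =>
      rw [Finset.sum_range_succ, add_assoc]
      exact (add_le_add le_rfl (step M)).trans ih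
  have hu0 : u 0 ≤ Φ init := by
    calc u 0 ≤ ∫⁻ _, Φ init ∂μ := lintegral_mono fun ω => Set.indicator_le_self _ _ _
      _ = Φ init := by simp
  calc _ ≤ ∫⁻ ω, ∑' m : ℕ, (B m).indicator (fun _ => (1 : ℝ≥0∞)) ω ∂μ :=
        lintegral_mono fun ω => firstAccurate_le_tsum A ℓ ε ω
    _ = ∑' m, μ (B m) := by
      rw [lintegral_tsum fun m => (measurable_const.indicator (hB m)).aemeasurable]
      exact tsum_congr fun m => lintegral_indicator_one (hB m)
    _ ≤ Φ init := by
      refine ENNReal.tsum_le_of_sum_range_le fun M => ?_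
      exact le_self_add.trans ((partial_sums M).trans hu0)

end

/-! ### Volumes of balls and slabs. -/

/-- Log-convexity of `Γ` at the midpoint of `x` and `x + 1`, together with `Γ(x + 1) = x Γ(x)`. -/
theorem Gamma_add_half_le {x : ℝ} (hx : 0 < x) :
    Real.Gamma (x + 1 / 2) ≤ Real.Gamma x * √x := by
  have h := Real.Gamma_mul_add_mul_le_rpow_Gamma_mul_rpow_Gamma hx (add_pos hx one_pos)
    (a := 1 / 2) (b := 1 / 2) (by norm_num) (by norm_num) (by norm_num)
  have hG := Real.Gamma_pos_of_pos hx
  rw [Real.Gamma_add_one hx.ne', Real.mul_rpow hx.le hG.le, ← Real.sqrt_eq_rpow,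
    ← Real.sqrt_eq_rpow] at h
  calc Real.Gamma (x + 1 / 2) = Real.Gamma (1 / 2 * x + 1 / 2 * (x + 1)) := by ring_nf
    _ ≤ _ := h
    _ = √(Real.Gamma x) * √(Real.Gamma x) * √x := by ring
    _ = _ := by rw [Real.mul_self_sqrt hG.le]

theorem Gamma_half_add_three_halves_le (m : ℕ) (hm : 1 ≤ m) :
    Real.Gamma ((m + 1 : ℕ) / 2 + 1) ≤ 2 ^ m / 2 * √Real.pi * Real.Gamma (m / 2 + 1) := by
  have hx : (0 : ℝ) < m / 2 + 1 := by positivity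
  have h := Gamma_add_half_le hx
  have h1 : ((m + 1 : ℕ) / 2 + 1 : ℝ) = m / 2 + 1 + 1 / 2 := by push_cast; ring
  have hm' : (1 : ℝ) ≤ m := by exact_mod_cast hm
  -- After squaring, the claim is `m / 2 + 1 ≤ 4 ^ m * π / 4`, which follows from Bernoulli's
  -- inequality and `π > 3` once `m ≥ 1`.
  have h4 : (1 : ℝ) + m * 3 ≤ 4 ^ m := by
    have := one_add_mul_le_pow (a := (3 : ℝ)) (by norm_num) m
    norm_num at this
    exact this
  have h2 : √(m / 2 + 1 : ℝ) ≤ 2 ^ m / 2 * √Real.pi := by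
    refine Real.sqrt_le_left (by positivity) |>.2 ?_
    rw [mul_pow, Real.sq_sqrt Real.pi_pos.le, div_pow, ← pow_mul, mul_comm m 2, pow_mul]
    norm_num
    nlinarith [Real.pi_gt_three]
  rw [h1]
  calc _ ≤ _ := h
    _ ≤ Real.Gamma (m / 2 + 1) * (2 ^ m / 2 * √Real.pi) := by
      gcongr
    _ = _ := by ring

/-- Comparison of the volumes of balls of radius `1/2` in consecutive dimensions. -/
theorem volume_closedBall_half_le {E F : Type*} [NormedAddCommGroup E] [InnerProductSpace ℝ E]
    [FiniteDimensional ℝ E] [MeasurableSpace E] [BorelSpace E] [NormedAddCommGroup F]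
    [InnerProductSpace ℝ F] [FiniteDimensional ℝ F] [MeasurableSpace F] [BorelSpace F] {m : ℕ}
    (hE : Module.finrank ℝ E = m + 1) (hF : Module.finrank ℝ F = m) :
    volume (Metric.closedBall (0 : F) (1 / 2)) ≤
      2 ^ m * volume (Metric.closedBall (0 : E) (1 / 2)) := by
  have : Nontrivial E := Module.nontrivial_of_finrank_pos (R := ℝ) (by lia)
  -- For `m = 0` both volumes are `1`, and the log-convexity estimate would be too weak.
  rcases Nat.eq_zero_or_pos m with rfl | hm
  · have : Subsingleton F := Module.finrank_zero_iff.1 hF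
    have h1 : volume (Metric.closedBall (0 : F) (1 / 2)) ≤ 1 := by
      have := OrthonormalBasis.volume_parallelepiped (stdOrthonormalBasis ℝ F)
      rw [← this]
      refine measure_mono fun x _ => ?_
      rw [Subsingleton.elim x 0, mem_parallelepiped_iff]
      exact ⟨0, by simp, by simp⟩
    have h2 : volume (Metric.closedBall (0 : E) (1 / 2)) = 1 := by
      rw [InnerProductSpace.volume_closedBall_of_dim_odd (k := 0) (by simpa using hE)]
      simp only [hE]
      rw [← ENNReal.ofReal_pow (by norm_num), ← ENNReal.ofReal_mul (by positivity)]
      norm_num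
    rw [h2]
    simpa only [pow_zero, mul_one] using h1
  · have : Nontrivial F := Module.nontrivial_of_finrank_pos (R := ℝ) (by lia)
    rw [InnerProductSpace.volume_closedBall, InnerProductSpace.volume_closedBall, hE, hF,
      ← ENNReal.ofReal_pow (by norm_num), ← ENNReal.ofReal_pow (by norm_num),
      ← ENNReal.ofReal_mul (by positivity), ← ENNReal.ofReal_mul (by positivity)]
    have h2 : (2 : ℝ≥0∞) ^ m = ENNReal.ofReal (2 ^ m) := by
      rw [ENNReal.ofReal_pow (by norm_num)]; norm_num
    rw [h2, ← ENNReal.ofReal_mul (by positivity)]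
    apply ENNReal.ofReal_le_ofReal
    have hG1 : 0 < Real.Gamma ((m : ℝ) / 2 + 1) := Real.Gamma_pos_of_pos (by positivity)
    have hG2 : 0 < Real.Gamma (((m + 1 : ℕ) : ℝ) / 2 + 1) := Real.Gamma_pos_of_pos (by positivity)
    have h := Gamma_half_add_three_halves_le m hm
    have h3 : (2 : ℝ) ^ m * ((1 / 2) ^ (m + 1) * (√Real.pi ^ (m + 1) /
        Real.Gamma (((m + 1 : ℕ) : ℝ) / 2 + 1))) = (1 / 2) ^ m * (√Real.pi ^ m *
        ((2 ^ m / 2 * √Real.pi) / Real.Gamma (((m + 1 : ℕ) : ℝ) / 2 + 1))) := by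
      rw [pow_succ, pow_succ]; ring
    rw [h3, div_eq_mul_inv]
    refine mul_le_mul_of_nonneg_left (mul_le_mul_of_nonneg_left ?_ (by positivity)) (by positivity)
    rw [le_div_iff₀ hG2, inv_mul_le_iff₀ hG1]
    linarith

theorem volume_span_singleton_slab {E : Type*} [NormedAddCommGroup E] [InnerProductSpace ℝ E]
    [MeasurableSpace E] [BorelSpace E] {n : E} (hn : ‖n‖ = 1) (a W : ℝ) :
    volume {x : Submodule.span ℝ {n} | |inner ℝ n (x : E) - a| ≤ W} = ENNReal.ofReal (2 * W) := by
  rw [← (LinearIsometryEquiv.toSpanUnitSingleton (𝕜 := ℝ) n hn).measurePreserving.measure_preimage]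
  · have : (LinearIsometryEquiv.toSpanUnitSingleton (𝕜 := ℝ) n hn) ⁻¹'
        {x : Submodule.span ℝ {n} | |inner ℝ n (x : E) - a| ≤ W} = Metric.closedBall a W := by
      ext r
      simp [inner_smul_right, hn, Real.dist_eq]
    rw [this, Real.volume_closedBall]
  · refine (IsClosed.measurableSet ?_).nullMeasurableSet
    exact isClosed_le (by fun_prop) (by fun_prop)

/-- The volume of the part of the ball between two parallel hyperplanes. -/
theorem volume_slab_inter_closedBall_le {E : Type*} [NormedAddCommGroup E] [InnerProductSpace ℝ E]
    [FiniteDimensional ℝ E] [MeasurableSpace E] [BorelSpace E] {m : ℕ}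
    (hE : Module.finrank ℝ E = m + 1) {n : E} (hn : ‖n‖ = 1) (a W : ℝ) :
    volume (Metric.closedBall (0 : E) (1 / 2) ∩ {x | |inner ℝ n x - a| ≤ W}) ≤
      ENNReal.ofReal (2 * W) * (2 ^ m * volume (Metric.closedBall (0 : E) (1 / 2))) := by
  set K := Submodule.span ℝ {n}
  have : Fact (Module.finrank ℝ E = m + 1) := ⟨hE⟩
  have hF : Module.finrank ℝ Kᗮ = m := Submodule.finrank_orthogonal_span_singleton (by
    rintro rfl; simp at hn)
  have hmp : MeasurePreserving (WithLp.ofLp ∘ K.orthogonalDecomposition) volume volume :=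
    (WithLp.volume_preserving_ofLp K Kᗮ).comp K.orthogonalDecomposition.measurePreserving
  set S : Set (K × Kᗮ) := {x : K | |inner ℝ n (x : E) - a| ≤ W} ×ˢ Metric.closedBall 0 (1 / 2)
  have hS : MeasurableSet S := by
    refine MeasurableSet.prod (IsClosed.measurableSet ?_) measurableSet_closedBall
    exact isClosed_le (by fun_prop) (by fun_prop)
  -- Splitting off the direction `n` places the slab inside an interval of length `2 * W` times a
  -- ball of the same radius in dimension `m`.
  calc _ ≤ volume ((WithLp.ofLp ∘ K.orthogonalDecomposition) ⁻¹' S) := by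
        refine measure_mono fun x hx => ?_
        obtain ⟨hx1, hx2⟩ := hx
        have h1 : inner ℝ n x = inner ℝ n (K.orthogonalProjectionOnto x : E) :=
          (Submodule.inner_orthogonalProjectionOnto_eq_of_mem_left
            (⟨n, Submodule.mem_span_singleton_self n⟩ : K) x).symm
        refine ⟨?_, ?_⟩
        · change |inner ℝ n (K.orthogonalProjectionOnto x : E) - a| ≤ W
          rw [← h1]
          exact hx2
        · simp only [mem_closedBall_zero_iff] at hx1 ⊢
          refine le_trans ?_ hx1
          simpa using Submodule.norm_orthogonalProjectionOnto_apply_le Kᗮ x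
    _ = volume S := hmp.measure_preimage hS.nullMeasurableSet
    _ = ENNReal.ofReal (2 * W) * volume (Metric.closedBall (0 : Kᗮ) (1 / 2)) := by
      rw [← volume_span_singleton_slab hn a W]
      exact Measure.prod_prod _ _
    _ ≤ _ := by
      gcongr
      exact volume_closedBall_half_le hE hF

theorem uniformBall_slab_le {k : ℕ} (hk : 1 ≤ k) {n : EuclideanSpace ℝ (Fin k)} (hn : ‖n‖ = 1)
    (a : ℝ) {W : ℝ} (hW : 0 ≤ W) {s : Set (Ball k)}
    (hsW : ∀ x ∈ s, |inner ℝ n (x : EuclideanSpace ℝ (Fin k)) - a| ≤ W) :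
    (uniformBall k).real s ≤ 2 ^ (k - 1) * (2 * W) := by
  set B := Metric.closedBall (0 : EuclideanSpace ℝ (Fin k)) (1 / 2)
  have hB : MeasurableSet B := measurableSet_closedBall
  have hB0 : volume B ≠ 0 := (Metric.measure_closedBall_pos _ _ (by norm_num)).ne'
  have hB1 : volume B ≠ ⊤ := measure_closedBall_lt_top.ne
  have h : uniformBall k s ≤ ENNReal.ofReal (2 ^ (k - 1) * (2 * W)) := by
    rw [uniformBall, (MeasurableEmbedding.subtype_coe hB).comap_apply, cond_apply hB,
      ENNReal.inv_mul_le_iff hB0 hB1]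
    calc _ ≤ volume (B ∩ {x | |inner ℝ n x - a| ≤ W}) := by
          refine measure_mono (Set.inter_subset_inter_right _ ?_)
          rintro _ ⟨x, hx, rfl⟩
          exact hsW x hx
      _ ≤ _ := volume_slab_inter_closedBall_le (m := k - 1) (by simp; lia) hn a W
      _ = _ := by
        rw [ENNReal.ofReal_mul (p := 2 ^ (k - 1)) (by positivity), ENNReal.ofReal_pow (by norm_num)]
        simp only [ENNReal.ofReal_ofNat, B]
        ring
  rw [measureReal_def]
  exact ENNReal.toReal_le_of_le_ofReal (by positivity) h

instance isProbabilityMeasure_uniformBall (k : ℕ) : IsProbabilityMeasure (uniformBall k) := by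
  have hB : MeasurableSet (Metric.closedBall (0 : EuclideanSpace ℝ (Fin k)) (1 / 2)) :=
    measurableSet_closedBall
  constructor
  rw [uniformBall, (MeasurableEmbedding.subtype_coe hB).comap_apply, cond_apply hB]
  simp only [Set.image_univ, Subtype.range_coe, Set.inter_self]
  exact ENNReal.inv_mul_cancel (Metric.measure_closedBall_pos _ _ (by norm_num)).ne'
    measure_closedBall_lt_top.ne

noncomputable section

/-! ### Projections onto a hyperplane and steps across it. -/

section Geometry

variable {E : Type*} [NormedAddCommGroup E] [InnerProductSpace ℝ E]

/-- The orthogonal projection onto the hyperplane `⟪n, x⟫ = b` with unit normal vector `n`. -/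
def hyperplaneProj (n : E) (b : ℝ) (y : E) : E :=
  y + (b - inner ℝ n y) • n

theorem inner_hyperplaneProj {n : E} (hn : ‖n‖ = 1) (b : ℝ) (y : E) :
    inner ℝ n (hyperplaneProj n b y) = b := by
  simp [hyperplaneProj, inner_add_right, inner_smul_right, hn]

theorem norm_hyperplaneProj_sub {n : E} (hn : ‖n‖ = 1) (b : ℝ) (y : E) :
    ‖hyperplaneProj n b y - y‖ = |b - inner ℝ n y| := by
  simp [hyperplaneProj, norm_smul, hn]

/-- Projecting replaces the normal component `⟨n, y⟩` by `b` and keeps the rest, so Pythagoras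
applies. This keeps projections inside the ball. -/
theorem norm_hyperplaneProj_le {n : E} (hn : ‖n‖ = 1) {b : ℝ} {y : E}
    (h : b ^ 2 ≤ (inner ℝ n y) ^ 2) : ‖hyperplaneProj n b y‖ ≤ ‖y‖ := by
  refine le_of_sq_le_sq ?_ (norm_nonneg y)
  rw [hyperplaneProj, norm_add_sq_real, inner_smul_right, norm_smul, hn, real_inner_comm n y,
    Real.norm_eq_abs, mul_one, sq_abs]
  linarith

theorem hyperplaneProj_lineMap (n : E) (b : ℝ) (y y' : E) (s : ℝ) :
    hyperplaneProj n b (AffineMap.lineMap y' y s) =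
      AffineMap.lineMap (hyperplaneProj n b y') (hyperplaneProj n b y) s := by
  simp only [hyperplaneProj, AffineMap.lineMap_apply_module, inner_add_right, inner_smul_right]
  module

/-- Uniqueness of the nearest point of the half-space; it identifies the ideal contrastive example.
-/
theorem eq_hyperplaneProj {n : E} (hn : ‖n‖ = 1) {b : ℝ} {y z : E} (hy : inner ℝ n y ≤ b)
    (hz : b ≤ inner ℝ n z) (h : ‖z - y‖ ≤ b - inner ℝ n y) : z = hyperplaneProj n b y := by
  rw [← sub_eq_zero, ← norm_eq_zero, ← sq_eq_zero_iff]
  refine le_antisymm ?_ (sq_nonneg _)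
  have h1 : z - hyperplaneProj n b y = (z - y) - (b - inner ℝ n y) • n := by
    rw [hyperplaneProj]; abel
  rw [h1, norm_sub_sq_real, inner_smul_right, norm_smul, hn, real_inner_comm n (z - y),
    inner_sub_right, Real.norm_eq_abs, mul_one, sq_abs]
  have h2 : ‖z - y‖ ^ 2 ≤ (b - inner ℝ n y) ^ 2 := by gcongr
  nlinarith

/-- The point at distance `t` from `y'` on the segment towards `y` (or `y`, if that is closer). -/
def stepToward (t : ℝ) (y y' : E) : E :=
  AffineMap.lineMap y' y (min 1 (t / ‖y - y'‖))

theorem norm_stepToward_sub_le {t : ℝ} (ht : 0 ≤ t) (y y' : E) :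
    ‖stepToward t y y' - y'‖ ≤ t := by
  have h0 : 0 ≤ min 1 (t / ‖y - y'‖) := le_min zero_le_one (by positivity)
  rw [stepToward, AffineMap.lineMap_apply, vadd_eq_add, add_sub_cancel_right, vsub_eq_sub,
    norm_smul, Real.norm_of_nonneg h0]
  calc _ ≤ t / ‖y - y'‖ * ‖y - y'‖ := by gcongr; exact min_le_right _ _
    _ ≤ t := by
      rcases eq_or_ne ‖y - y'‖ 0 with h | h
      · simpa [h] using ht
      · rw [div_mul_cancel₀ _ h]

theorem stepToward_mem {s : Set E} (hs : Convex ℝ s) {t : ℝ} (ht : 0 ≤ t) {y y' : E}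
    (hy : y ∈ s) (hy' : y' ∈ s) : stepToward t y y' ∈ s :=
  hs.lineMap_mem hy' hy ⟨le_min zero_le_one (by positivity), min_le_left _ _⟩

theorem sub_inner_stepToward_le {n : E} (hn : ‖n‖ = 1) {b t : ℝ} (ht : 0 ≤ t) {y y' : E}
    (hy' : b ≤ inner ℝ n y') : b - inner ℝ n (stepToward t y y') ≤ t := by
  have h1 : inner ℝ n (y' - stepToward t y y') ≤ ‖n‖ * ‖y' - stepToward t y y'‖ :=
    real_inner_le_norm _ _
  rw [hn, one_mul, norm_sub_rev, inner_sub_right] at h1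
  linarith [norm_stepToward_sub_le ht y y']

/-- The projection is affine and the ball is convex. -/
theorem norm_hyperplaneProj_stepToward_le {n : E} {b r t : ℝ} (ht : 0 ≤ t) {y y' : E}
    (hy : ‖hyperplaneProj n b y‖ ≤ r) (hy' : ‖hyperplaneProj n b y'‖ ≤ r) :
    ‖hyperplaneProj n b (stepToward t y y')‖ ≤ r := by
  rw [stepToward, hyperplaneProj_lineMap, ← mem_closedBall_zero_iff]
  exact (convex_closedBall _ _).lineMap_mem (mem_closedBall_zero_iff.2 hy')
    (mem_closedBall_zero_iff.2 hy) ⟨le_min zero_le_one (by positivity), min_le_left _ _⟩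

/-- A step longer than the distance of `y'` to the projection of `y` crosses the hyperplane. -/
theorem inner_stepToward_lt {n : E} (hn : ‖n‖ = 1) {b t ρ : ℝ} {y y' : E}
    (hy : inner ℝ n y < b) (hy' : b ≤ inner ℝ n y') (hρ : ‖y' - hyperplaneProj n b y‖ ≤ ρ)
    (ht : ρ < t) : inner ℝ n (stepToward t y y') < b := by
  have hL : 0 < ‖y - y'‖ := by
    rw [norm_pos_iff, sub_ne_zero]
    rintro rfl
    linarith
  have h1 : ‖y - y'‖ ≤ (b - inner ℝ n y) + ρ := by
    calc ‖y - y'‖ = ‖(hyperplaneProj n b y - y) + (y' - hyperplaneProj n b y)‖ := by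
          rw [norm_sub_rev]; congr 1; abel
      _ ≤ ‖hyperplaneProj n b y - y‖ + ‖y' - hyperplaneProj n b y‖ := norm_add_le _ _
      _ ≤ _ := by
        rw [norm_hyperplaneProj_sub hn, abs_of_pos (by linarith)]
        gcongr
  have h2 : inner ℝ n y' - b ≤ ρ := by
    have := real_inner_le_norm n (y' - hyperplaneProj n b y)
    rw [inner_sub_right, inner_hyperplaneProj hn, hn, one_mul] at this
    linarith
  rw [stepToward, AffineMap.lineMap_apply_module, inner_add_right, inner_smul_right,
    inner_smul_right]
  rcases le_total 1 (t / ‖y - y'‖) with h | h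
  · rw [min_eq_left h]
    linarith
  · rw [min_eq_right h]
    -- With `u = ⟨n, y'⟩ - b ≤ ρ` and `d = b - ⟨n, y⟩`, the left side is at most `u (d + ρ) ≤ ρ (u +
    -- d) < t (u + d)`.
    have h3 : (inner ℝ n y' - b) * ‖y - y'‖ < t * (inner ℝ n y' - inner ℝ n y) := by
      nlinarith [mul_le_mul_of_nonneg_left h1 (sub_nonneg.2 hy')]
    have h4 : inner ℝ n y' - b < t / ‖y - y'‖ * (inner ℝ n y' - inner ℝ n y) := by
      rw [div_mul_eq_mul_div, lt_div_iff₀ hL]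
      exact h3
    linarith

/-- Points on which the half-space perpendicular to `y' - y` through `y'` and the true half-space
disagree are close to a hyperplane. -/
theorem abs_inner_sub_le_of_disagree {n : E} (hn : ‖n‖ = 1) {b ρ : ℝ} {x y y' : E}
    (hy : inner ℝ n y < b) (hd : b - inner ℝ n y ≤ 1) (hρ : ‖y' - hyperplaneProj n b y‖ ≤ ρ)
    (hx : ‖x - y'‖ ≤ 1) (h : ¬ (inner ℝ (y' - y) y' ≤ inner ℝ (y' - y) x ↔ b ≤ inner ℝ n x)) :
    |inner ℝ n x - inner ℝ n y'| ≤ ρ / (b - inner ℝ n y) := by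
  set d := b - inner ℝ n y with hd_def
  set e := y' - hyperplaneProj n b y with he
  have hd0 : 0 < d := by linarith
  have h1 : y' - y = d • n + e := by rw [he, hyperplaneProj]; abel
  have h2 : inner ℝ n y' = b + inner ℝ n e := by
    rw [he, inner_sub_right, inner_hyperplaneProj hn]; ring
  have h3 : inner ℝ (y' - y) x - inner ℝ (y' - y) y' =
      d * (inner ℝ n x - inner ℝ n y') + inner ℝ e (x - y') := by
    rw [h1, inner_add_left, inner_add_left, inner_smul_left, inner_smul_left, inner_sub_right]
    simp only [conj_trivial]
    ring
  have h4 : |inner ℝ n e| ≤ ρ := by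
    have := abs_real_inner_le_norm n e
    rw [hn, one_mul] at this
    exact this.trans hρ
  have h5 : |inner ℝ e (x - y')| ≤ ρ := by
    refine (abs_real_inner_le_norm _ _).trans ?_
    calc ‖e‖ * ‖x - y'‖ ≤ ρ * 1 := by gcongr; exact (norm_nonneg _).trans hρ
      _ = ρ := mul_one ρ
  have hρ0 : 0 ≤ ρ := (norm_nonneg _).trans hρ
  set σ := inner ℝ n x - inner ℝ n y' with hσ
  rw [abs_le] at h4 h5
  have h6 : |σ| * d = |σ * d| := by rw [abs_mul, abs_of_pos hd0]
  rw [le_div_iff₀ hd0, h6, abs_le]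
  -- In each case the true label bounds `σ` by `ρ` on one side, and `d ≤ 1` carries this over to `σ
  -- * d`; the opposite label under the hypothesis bounds `σ * d` on the other side through `h3` and
  -- `h5`.
  rcases le_or_gt b (inner ℝ n x) with hb | hb
  · have h6 : inner ℝ (y' - y) x < inner ℝ (y' - y) y' := by
      by_contra h7
      exact h ⟨fun _ => hb, fun _ => not_lt.1 h7⟩
    have h7 : -ρ ≤ σ := by linarith
    constructor
    · nlinarith
    · nlinarith
  · have h6 : inner ℝ (y' - y) y' ≤ inner ℝ (y' - y) x := by
      by_contra h7
      exact h ⟨fun h8 => absurd h8 h7, fun h8 => absurd h8 (not_le.2 hb)⟩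
    have h7 : σ ≤ ρ := by linarith
    constructor
    · nlinarith
    · nlinarith

end Geometry

/-! ### What the oracle's answers reveal. -/

section Oracle

variable {k : ℕ}

/-- The half-space of the ball with normal vector `w` and offset `b`. -/
def ballHalfSpace (k : ℕ) (w : EuclideanSpace ℝ (Fin k)) (b : ℝ) : Set (Ball k) :=
  {x : Ball k | b ≤ inner ℝ w (x : EuclideanSpace ℝ (Fin k))}

theorem isClosed_ballHalfSpace (w : EuclideanSpace ℝ (Fin k)) (b : ℝ) :
    IsClosed (ballHalfSpace k w b) :=
  isClosed_le (by fun_prop) (by fun_prop)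

theorem ballHalfSpace_mem_halfSpaces (w : EuclideanSpace ℝ (Fin k)) (b : ℝ) :
    ballHalfSpace k w b ∈ halfSpaces k := ⟨w, b, rfl⟩

theorem exists_unit_normal {ℓ : Set (Ball k)} (hℓ : ℓ ∈ halfSpaces k) {x y : Ball k}
    (hxy : ¬ (x ∈ ℓ ↔ y ∈ ℓ)) :
    ∃ (n : EuclideanSpace ℝ (Fin k)) (b : ℝ), ‖n‖ = 1 ∧ ℓ = ballHalfSpace k n b := by
  obtain ⟨w, b, rfl⟩ := hℓ
  have hw : w ≠ 0 := by
    rintro rfl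
    simp at hxy
  have hw' : 0 < ‖w‖ := norm_pos_iff.2 hw
  refine ⟨‖w‖⁻¹ • w, ‖w‖⁻¹ * b, by simp [norm_smul, hw], ?_⟩
  ext x
  simp only [ballHalfSpace, inner_smul_left, conj_trivial, Set.mem_ofPred_eq]
  exact (mul_le_mul_iff_of_pos_left (inv_pos.2 hw')).symm

/-- A probability distribution cannot live on the empty set, so a constant labeling has no oracle;
only targets with a unit normal remain. -/
theorem ProbOracle.exists_mem_oppositeLabel {X : Type*} [MetricSpace X] [MeasurableSpace X]
    {f : ℝ≥0 → ℝ≥0} {ℓ : Set X} (O : ProbOracle f ℓ) (x : X) : ∃ y, y ∈ oppositeLabel ℓ x :=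
  (O.label_ne x).exists

/-- With probability at least one half, the contrastive example for a point outside the half-space
is near the orthogonal projection of the point. -/
theorem ProbOracle.measure_far_le {f : ℝ≥0 → ℝ≥0} {n : EuclideanSpace ℝ (Fin k)} (hn : ‖n‖ = 1)
    {b : ℝ} (O : ProbOracle f (ballHalfSpace k n b)) {y : Ball k}
    (hy : inner ℝ n (y : EuclideanSpace ℝ (Fin k)) < b)
    (hP : ‖hyperplaneProj n b (y : EuclideanSpace ℝ (Fin k))‖ ≤ 1 / 2) :
    O.D y {y' : Ball k | 2 * (f (b - inner ℝ n (y : EuclideanSpace ℝ (Fin k))).toNNReal : ℝ) <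
      ‖(y' : EuclideanSpace ℝ (Fin k)) - hyperplaneProj n b y‖} ≤ 1 / 2 := by
  set d := b - inner ℝ n (y : EuclideanSpace ℝ (Fin k)) with hd
  have hd0 : 0 < d := by linarith
  set p : Ball k := ⟨hyperplaneProj n b y, mem_closedBall_zero_iff.2 hP⟩
  have hopp : oppositeLabel (ballHalfSpace k n b) y = ballHalfSpace k n b := by
    ext z
    have : y ∉ ballHalfSpace k n b := not_le.2 hy
    simp [oppositeLabel, this]
  obtain ⟨q, ⟨hq1, hq2⟩, hq3⟩ := O.expected_dist_le y
  rw [hopp, (isClosed_ballHalfSpace n b).closure_eq] at hq1 hq2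
  have hdist : dist y p = d := by
    rw [Subtype.dist_eq, dist_comm, dist_eq_norm, norm_hyperplaneProj_sub hn, abs_of_pos hd0]
  have hqp : q = p := by
    refine Subtype.ext (eq_hyperplaneProj hn hy.le hq1 ?_)
    have := hq2 p (inner_hyperplaneProj hn b _).ge
    rwa [hdist, Subtype.dist_eq, dist_comm, dist_eq_norm] at this
  subst hqp
  have hnn : nndist y p = d.toNNReal := by
    rw [← hdist, ← coe_nndist, Real.toNNReal_coe]
  rw [hnn] at hq3
  have hint := hq3 (Real.toNNReal_pos.2 hd0)
  have hset : {y' : Ball k | 2 * (f d.toNNReal : ℝ) <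
      ‖(y' : EuclideanSpace ℝ (Fin k)) - hyperplaneProj n b y‖} =
      {y' : Ball k | 2 * (f d.toNNReal : ℝ≥0∞) < edist y' p} := by
    ext y'
    have : ‖(y' : EuclideanSpace ℝ (Fin k)) - hyperplaneProj n b y‖ = nndist y' p := by
      rw [coe_nndist, Subtype.dist_eq, dist_eq_norm]
    simp only [Set.mem_ofPred_eq]
    rw [this, edist_nndist]
    exact_mod_cast Iff.rfl
  rw [hset]
  have hmeas : Measurable fun y' : Ball k => edist y' p := by fun_prop
  -- Markov's inequality at threshold `0` says nothing; in that case the contrastive example equals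
  -- the projection almost surely.
  rcases eq_or_ne (f d.toNNReal) 0 with h0 | h0
  · rw [h0] at hint ⊢
    have h1 : ∫⁻ x', edist x' p ∂(O.D y) = 0 := le_antisymm hint zero_le
    rw [lintegral_eq_zero_iff hmeas] at h1
    have h2 : O.D y {y' : Ball k | 2 * ((0 : ℝ≥0) : ℝ≥0∞) < edist y' p} = 0 := by
      rw [measure_eq_zero_iff_ae_notMem]
      filter_upwards [h1] with x hx
      simp only [Pi.zero_apply] at hx
      simp [hx]
    rw [h2]
    exact zero_le
  · have h1 : 2 * (f d.toNNReal : ℝ≥0∞) * O.D y {y' : Ball k | 2 * (f d.toNNReal : ℝ≥0∞) ≤ edist y' p}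
        ≤ f d.toNNReal := (mul_meas_ge_le_lintegral hmeas _).trans hint
    have h2 : O.D y {y' : Ball k | 2 * (f d.toNNReal : ℝ≥0∞) < edist y' p} ≤
        O.D y {y' : Ball k | 2 * (f d.toNNReal : ℝ≥0∞) ≤ edist y' p} :=
      by
      refine measure_mono fun x hx => ?_
      rw [Set.mem_ofPred_eq] at hx ⊢
      exact hx.le
    refine h2.trans ?_
    have hf0 : (f d.toNNReal : ℝ≥0∞) ≠ 0 := by exact_mod_cast h0
    rw [ENNReal.le_div_iff_mul_le (by simp) (by simp),
      ← ENNReal.mul_le_mul_iff_right hf0 ENNReal.coe_ne_top, mul_one]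
    calc _ = _ := by ring
      _ ≤ _ := h1

end Oracle

theorem lintegral_obsKernel {X : Type*} [MeasurableSpace X] {ℓ : Set X} (hℓ : MeasurableSet ℓ)
    (D : Kernel X X) [IsMarkovKernel D] (x : X) {G : Obs X → ℝ≥0∞} (hG : Measurable G) :
    ∫⁻ o, G o ∂(obsKernel ℓ D x) = ∫⁻ x', G (toObs ℓ (x, x')) ∂(D x) := by
  rw [obsKernel, Kernel.lintegral_map _ (measurable_toObs hℓ) _ hG, Kernel.prod_apply,
    Kernel.id_apply, Measure.dirac_prod]
  exact lintegral_map (hG.comp (measurable_toObs hℓ)) measurable_prodMk_left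

/-! ### The learner and its potential. -/

section Learner

variable {k : ℕ}

/-- The memory of the learner: the phase (`0`: query the center; `1`: query the point `y`;
otherwise: query a point near the contrastive example `y'` of `y`), the number of remaining levels,
and the points `y` and `y'`. -/
abbrev Memory (k : ℕ) : Type := ℕ × ℕ × Ball k × Ball k

/-- The center of the ball. -/
def ballCenter (k : ℕ) : Ball k := ⟨0, Metric.mem_closedBall_self (by norm_num)⟩

/-- `stepToward` within the ball. -/
def ballStep (t : ℝ≥0) (y y' : Ball k) : Ball k :=
  ⟨stepToward t (y : EuclideanSpace ℝ (Fin k)) y',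
    stepToward_mem (convex_closedBall _ _) t.2 y.2 y'.2⟩

theorem measurable_ballStep :
    Measurable fun p : ℝ≥0 × Ball k × Ball k => ballStep p.1 p.2.1 p.2.2 := by
  refine Measurable.subtype_mk ?_
  simp only [stepToward, AffineMap.lineMap_apply_module]
  fun_prop

open Classical in
/-- The transition function of the learner. -/
def nextMemory (J : ℕ) (s : Memory k) (o : Obs (Ball k)) : Memory k :=
  if s.1 = 0 then (1, J, if o.1.2 then o.2.1 else o.1.1, o.1.1)
  else if s.1 = 1 then (2, s.2.1, s.2.2.1, o.2.1)
  -- A test point still inside the half-space means a failed attempt, and `y` is kept. Truncated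
  -- subtraction lets level `0` repeat itself.
  else if o.1.2 then (1, s.2) else (1, s.2.1 - 1, o.1.1, s.2.2.2)

theorem measurable_nextMemory (J : ℕ) :
    Measurable fun p : Memory k × Obs (Ball k) => nextMemory J p.1 p.2 := by
  have h0 : ∀ i : ℕ, MeasurableSet {p : Memory k × Obs (Ball k) | p.1.1 = i} := fun i =>
    (measurable_fst.comp measurable_fst) (measurableSet_singleton i)
  have h1 : MeasurableSet {p : Memory k × Obs (Ball k) | p.2.1.2} :=
    measurableSet_setOfPred.2 (by fun_prop)
  have h2 : Measurable fun p : Memory k × Obs (Ball k) => p.1.2.1 - 1 :=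
    (measurable_of_countable fun n : ℕ => n - 1).comp (by fun_prop)
  unfold nextMemory
  refine Measurable.ite (h0 0) ?_ (Measurable.ite (h0 1) ?_ (Measurable.ite h1 ?_ ?_))
  · exact measurable_const.prodMk (measurable_const.prodMk
      ((Measurable.ite h1 (by fun_prop) (by fun_prop)).prodMk (by fun_prop)))
  · fun_prop
  · fun_prop
  · exact measurable_const.prodMk (h2.prodMk (by fun_prop))

/-- The point tested in the last phase. -/
def testPoint (T : ℕ → ℝ≥0) (s : Memory k) : Ball k :=
  ballStep (T (s.2.1 - 1)) s.2.2.1 s.2.2.2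

theorem measurable_testPoint (T : ℕ → ℝ≥0) : Measurable (testPoint (k := k) T) := by
  have hr : Measurable fun s : Memory k => s.2.1 := by fun_prop
  have h : Measurable fun s : Memory k => T (s.2.1 - 1) :=
    (measurable_of_countable fun n : ℕ => T (n - 1)).comp hr
  have hy : Measurable fun s : Memory k => s.2.2 := by fun_prop
  change Measurable ((fun p : ℝ≥0 × Ball k × Ball k => ballStep p.1 p.2.1 p.2.2) ∘
    fun s : Memory k => (T (s.2.1 - 1), s.2.2))
  exact measurable_ballStep.comp (h.prodMk hy)

/-- The query of the learner. -/
def nextQuery (T : ℕ → ℝ≥0) (s : Memory k) : Ball k :=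
  if s.1 = 0 then ballCenter k else if s.1 = 1 then s.2.2.1 else testPoint T s

theorem measurableSet_phase (i : ℕ) : MeasurableSet {s : Memory k | s.1 = i} :=
  measurable_fst (measurableSet_singleton i)

theorem measurable_nextQuery (T : ℕ → ℝ≥0) : Measurable (nextQuery (k := k) T) :=
  Measurable.ite (measurableSet_phase 0) measurable_const
    (Measurable.ite (measurableSet_phase 1) (by fun_prop) (measurable_testPoint T))

/-- The hypothesis of the learner: the half-space perpendicular to `y' - y` through `y'`. -/
def currentHyp (s : Memory k) : Set (Ball k) :=
  ballHalfSpace k ((s.2.2.2 : EuclideanSpace ℝ (Fin k)) - s.2.2.1)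
    (inner ℝ ((s.2.2.2 : EuclideanSpace ℝ (Fin k)) - s.2.2.1) (s.2.2.2 : EuclideanSpace ℝ (Fin k)))

theorem measurable_err_currentHyp {ℓ : Set (Ball k)} (hℓ : MeasurableSet ℓ) :
    Measurable fun s : Memory k => err (uniformBall k) (currentHyp s) ℓ := by
  have hM : MeasurableSet {p : Memory k × Ball k | ¬ (p.2 ∈ currentHyp p.1 ↔ p.2 ∈ ℓ)} := by
    refine measurableSet_setOfPred.2 (Measurable.not (Measurable.iff ?_ ?_))
    · have hf : Measurable fun p : Memory k × Ball k =>
          inner ℝ ((p.1.2.2.2 : EuclideanSpace ℝ (Fin k)) - p.1.2.2.1)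
            (p.1.2.2.2 : EuclideanSpace ℝ (Fin k)) := by fun_prop
      have hg : Measurable fun p : Memory k × Ball k =>
          inner ℝ ((p.1.2.2.2 : EuclideanSpace ℝ (Fin k)) - p.1.2.2.1)
            (p.2 : EuclideanSpace ℝ (Fin k)) := by fun_prop
      exact measurableSet_setOfPred.1 (measurableSet_le hf hg)
    · exact (measurableSet_setOfPred.1 hℓ).comp measurable_snd
  exact (measurable_measure_prodMk_left hM).ennreal_toReal

/-- The learner with target distances `T r` at `r` remaining levels, starting with `J` levels. -/
def levelLearner (k : ℕ) (T : ℕ → ℝ≥0) (J : ℕ) : ActiveLearner (uniformBall k) (halfSpaces k) :=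
  automatonLearner (0, 0, ballCenter k, ballCenter k) (nextMemory J) (measurable_nextMemory J)
    (nextQuery T) (measurable_nextQuery T) currentHyp
    (fun _ => ballHalfSpace_mem_halfSpaces _ _)
    (fun ℓ hℓ => measurable_err_currentHyp (measurableSet_of_mem_halfSpaces k ℓ hℓ))

/-- The point `y` lies outside the half-space, projects into the ball, and is as close to the
half-space as the level requires; in the last phase `y'` lies in the half-space. -/
def Memory.Valid (n : EuclideanSpace ℝ (Fin k)) (b : ℝ) (T : ℕ → ℝ≥0) (J : ℕ) (s : Memory k) :
    Prop :=
  (inner ℝ n (s.2.2.1 : EuclideanSpace ℝ (Fin k)) < b ∧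
    ‖hyperplaneProj n b (s.2.2.1 : EuclideanSpace ℝ (Fin k))‖ ≤ 1 / 2) ∧
  (b - inner ℝ n (s.2.2.1 : EuclideanSpace ℝ (Fin k)) ≤ T s.2.1 ∧ s.2.1 ≤ J) ∧
  (s.1 = 1 ∨ b ≤ inner ℝ n (s.2.2.2 : EuclideanSpace ℝ (Fin k)))

open Classical in
/-- An upper bound for the expected number of remaining steps. -/
def potential (n : EuclideanSpace ℝ (Fin k)) (b : ℝ) (T : ℕ → ℝ≥0) (J : ℕ) (s : Memory k) : ℝ≥0∞ :=
  -- The constants solve the recursion for success probability `1/2`: `E 0 = 1 + (1 + E 0) / 2`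
  -- gives `3`, and `E r = 1 + (1 + E (r - 1)) / 2 + (1 + E r) / 2` gives `E r = E (r - 1) + 4`. The
  -- query of the center adds `1`. The value `⊤` off the invariant makes the drift inequality
  -- trivial there.
  if s.1 = 0 then 4 * J + 4
  else if s.Valid n b T J then
    if s.1 = 1 then 4 * s.2.1 + 3
    else if inner ℝ n (testPoint T s : EuclideanSpace ℝ (Fin k)) < b then
      1 + (4 * (s.2.1 - 1 : ℕ) + 3)
    else 1 + (4 * s.2.1 + 3)
  else ⊤

theorem measurable_potential (n : EuclideanSpace ℝ (Fin k)) (b : ℝ) (T : ℕ → ℝ≥0) (J : ℕ) :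
    Measurable (potential n b T J) := by
  have hT : Measurable fun s : Memory k => ((T s.2.1 : ℝ≥0) : ℝ) :=
    (measurable_of_countable fun n : ℕ => (T n : ℝ)).comp (by fun_prop)
  have hn : ∀ g : ℕ → ℝ≥0∞, Measurable fun s : Memory k => g s.2.1 := fun g =>
    (measurable_of_countable g).comp (by fun_prop)
  have hV : MeasurableSet {s : Memory k | s.Valid n b T J} := by
    have hy : Measurable fun s : Memory k =>
        inner ℝ n (s.2.2.1 : EuclideanSpace ℝ (Fin k)) := by fun_prop
    have hy' : Measurable fun s : Memory k =>
        inner ℝ n (s.2.2.2 : EuclideanSpace ℝ (Fin k)) := by fun_prop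
    have hP : Measurable fun s : Memory k =>
        ‖hyperplaneProj n b (s.2.2.1 : EuclideanSpace ℝ (Fin k))‖ := by
      unfold hyperplaneProj
      fun_prop
    have hr : Measurable fun s : Memory k => s.2.1 := by fun_prop
    exact ((measurableSet_lt hy measurable_const).inter
      (measurableSet_le hP measurable_const)).inter
      (((measurableSet_le (measurable_const.sub hy) hT).inter
      (measurableSet_le hr measurable_const)).inter
      ((measurableSet_phase 1).union (measurableSet_le measurable_const hy')))
  have htest : MeasurableSet
      {s : Memory k | inner ℝ n (testPoint T s : EuclideanSpace ℝ (Fin k)) < b} := by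
    have hz : Measurable fun x : Ball k => inner ℝ n (x : EuclideanSpace ℝ (Fin k)) := by fun_prop
    exact measurableSet_lt (hz.comp (measurable_testPoint T)) measurable_const
  exact Measurable.ite (measurableSet_phase 0) measurable_const (Measurable.ite hV
    (Measurable.ite (measurableSet_phase 1) (hn fun r => 4 * r + 3)
      (Measurable.ite htest (hn fun r => 1 + (4 * (r - 1 : ℕ) + 3)) (hn fun r => 1 + (4 * r + 3))))
    measurable_const)

theorem norm_hyperplaneProj_le_half {n : EuclideanSpace ℝ (Fin k)} (hn : ‖n‖ = 1) {b : ℝ}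
    (y : Ball k) (h : b ^ 2 ≤ (inner ℝ n (y : EuclideanSpace ℝ (Fin k))) ^ 2) :
    ‖hyperplaneProj n b (y : EuclideanSpace ℝ (Fin k))‖ ≤ 1 / 2 :=
  (norm_hyperplaneProj_le hn h).trans (mem_closedBall_zero_iff.1 y.2)

theorem abs_inner_ball_le {n : EuclideanSpace ℝ (Fin k)} (hn : ‖n‖ = 1) (y : Ball k) :
    |inner ℝ n (y : EuclideanSpace ℝ (Fin k))| ≤ 1 / 2 := by
  have := abs_real_inner_le_norm n (y : EuclideanSpace ℝ (Fin k))
  rw [hn, one_mul] at this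
  exact this.trans (mem_closedBall_zero_iff.1 y.2)

/-- The hypothesis is accurate after a good contrastive example for a point near the boundary. -/
theorem err_currentHyp_le (hk : 1 ≤ k) {n : EuclideanSpace ℝ (Fin k)} (hn : ‖n‖ = 1) {b ρ : ℝ}
    {s : Memory k} (hy : inner ℝ n (s.2.2.1 : EuclideanSpace ℝ (Fin k)) < b)
    (hP : ‖hyperplaneProj n b (s.2.2.1 : EuclideanSpace ℝ (Fin k))‖ ≤ 1 / 2)
    (hρ : ‖(s.2.2.2 : EuclideanSpace ℝ (Fin k)) - hyperplaneProj n b s.2.2.1‖ ≤ ρ) :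
    err (uniformBall k) (currentHyp s) (ballHalfSpace k n b) ≤
      2 ^ (k - 1) * (2 * (ρ / (b - inner ℝ n (s.2.2.1 : EuclideanSpace ℝ (Fin k))))) := by
  have hρ0 : 0 ≤ ρ := (norm_nonneg _).trans hρ
  have hd : b - inner ℝ n (s.2.2.1 : EuclideanSpace ℝ (Fin k)) ≤ 1 := by
    have h1 := abs_real_inner_le_norm n (hyperplaneProj n b (s.2.2.1 : EuclideanSpace ℝ (Fin k)))
    rw [inner_hyperplaneProj hn, hn, one_mul] at h1
    have h2 := abs_le.1 (h1.trans hP)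
    have h3 := abs_le.1 (abs_inner_ball_le hn s.2.2.1)
    linarith
  refine uniformBall_slab_le hk hn
    (inner ℝ n (s.2.2.2 : EuclideanSpace ℝ (Fin k))) (div_nonneg hρ0 (by linarith)) fun x hx => ?_
  refine abs_inner_sub_le_of_disagree hn hy hd hρ ?_ hx
  refine (norm_sub_le _ _).trans ?_
  have h1 := mem_closedBall_zero_iff.1 x.2
  have h2 := mem_closedBall_zero_iff.1 s.2.2.2.2
  linarith

/-- One step of the learner decreases the potential in expectation. -/
theorem potential_drift (hk : 1 ≤ k) {f : ℝ≥0 → ℝ≥0} {n : EuclideanSpace ℝ (Fin k)}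
    (hn : ‖n‖ = 1) {b ε : ℝ} {ℓ : Set (Ball k)} (hℓ_def : ℓ = ballHalfSpace k n b)
    (O : ProbOracle f ℓ) {T : ℕ → ℝ≥0} {J : ℕ}
    (hTJ : 1 / 2 ≤ T J) (hT : ∀ r < J, ∀ d ≤ T (r + 1), 2 * f d < T r)
    (hT0 : ∀ d ≤ T 0, 0 < d → 2 ^ (k - 1) * (2 * (2 * (f d : ℝ) / d)) ≤ ε) (s : Memory k) :
    1 + ∫⁻ o, {s : Memory k | ε < err (uniformBall k) (currentHyp s) ℓ}.indicator
        (potential n b T J) (nextMemory J s o) ∂(obsKernel ℓ O.D (nextQuery T s)) ≤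
      potential n b T J s := by
  have hℓ : MeasurableSet ℓ := hℓ_def ▸ (isClosed_ballHalfSpace n b).measurableSet
  set W : Set (Memory k) := {s | ε < err (uniformBall k) (currentHyp s) ℓ}
  have hW : MeasurableSet W := measurableSet_lt measurable_const (measurable_err_currentHyp hℓ)
  have hmem : ∀ x : Ball k, x ∈ ℓ ↔ b ≤ inner ℝ n (x : EuclideanSpace ℝ (Fin k)) := by
    rw [hℓ_def]; exact fun _ => Iff.rfl
  have hG : Measurable fun o => W.indicator (potential n b T J) (nextMemory J s o) :=
    ((measurable_potential n b T J).indicator hW).comp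
      ((measurable_nextMemory J).comp (measurable_const.prodMk measurable_id))
  rw [lintegral_obsKernel hℓ O.D (nextQuery T s) hG]
  have hconst : ∀ C : ℝ≥0∞, (∀ x' ∈ oppositeLabel ℓ (nextQuery T s),
      potential n b T J (nextMemory J s (toObs ℓ (nextQuery T s, x'))) ≤ C) →
      ∫⁻ x', W.indicator (potential n b T J) (nextMemory J s (toObs ℓ (nextQuery T s, x')))
        ∂(O.D (nextQuery T s)) ≤ C := by
    intro C hC
    calc _ ≤ ∫⁻ _, C ∂(O.D (nextQuery T s)) := by
          refine lintegral_mono_ae ?_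
          filter_upwards [O.label_ne (nextQuery T s)] with x' hx'
          exact (Set.indicator_le_self _ _ _).trans (hC x' hx')
      _ = C := by simp
  by_cases h0 : s.1 = 0
  · have hq : nextQuery T s = ballCenter k := if_pos h0
    have hpot : potential n b T J s = 1 + (4 * J + 3) := by
      rw [potential, if_pos h0, show (4 : ℝ≥0∞) = 1 + 3 by norm_num]
      ring
    rw [hpot]
    gcongr
    refine hconst _ fun x' hx' => ?_
    rw [hq] at hx' ⊢
    have hc : ballCenter k ∈ ℓ ↔ b ≤ 0 := by
      rw [hmem]; simp [ballCenter]
    have hc0 : inner ℝ n (ballCenter k : EuclideanSpace ℝ (Fin k)) = 0 := by simp [ballCenter]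
    have hx'n := abs_le.1 (abs_inner_ball_le hn x')
    have hx'' : ¬ (b ≤ inner ℝ n (x' : EuclideanSpace ℝ (Fin k)) ↔ b ≤ 0) := by
      rw [← hmem, ← hc]; exact hx'
    suffices h : (nextMemory J s (toObs ℓ (ballCenter k, x'))).Valid n b T J by
      have h1 : (nextMemory J s (toObs ℓ (ballCenter k, x'))).1 = 1 := by simp [nextMemory, h0]
      have h2 : (nextMemory J s (toObs ℓ (ballCenter k, x'))).2.1 = J := by simp [nextMemory, h0]
      rw [potential, if_neg (by rw [h1]; norm_num), if_pos h, if_pos h1, h2]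
    -- If the center is inside, its contrastive example satisfies `⟨n, x'⟩ < b ≤ 0`, so projecting
    -- it shrinks the norm. If the center is outside, it projects to a point of norm `b`, and `b ≤
    -- ⟨n, x'⟩ ≤ 1/2`.
    by_cases hb : b ≤ 0
    · have hx : inner ℝ n (x' : EuclideanSpace ℝ (Fin k)) < b := by
        by_contra h
        exact hx'' ⟨fun _ => hb, fun _ => not_lt.1 h⟩
      have hnext : nextMemory J s (toObs ℓ (ballCenter k, x')) = (1, J, x', ballCenter k) := by
        simp [nextMemory, h0, toObs, hc, hb]
      rw [hnext]
      exact ⟨⟨hx, norm_hyperplaneProj_le_half hn x' (by nlinarith)⟩,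
        ⟨by simp only; linarith, le_rfl⟩, Or.inl rfl⟩
    · have hx : b ≤ inner ℝ n (x' : EuclideanSpace ℝ (Fin k)) := by
        by_contra h
        exact hx'' ⟨fun h' => absurd h' h, fun h' => absurd h' hb⟩
      have hnext : nextMemory J s (toObs ℓ (ballCenter k, x')) =
          (1, J, ballCenter k, ballCenter k) := by
        simp [nextMemory, h0, toObs, hc, hb]
      rw [hnext]
      push Not at hb
      refine ⟨⟨by simpa only [hc0] using hb, ?_⟩, ⟨?_, le_rfl⟩, Or.inl rfl⟩
      · simp only [hyperplaneProj, ballCenter, inner_zero_right, sub_zero, zero_add, norm_smul, hn,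
          mul_one, Real.norm_eq_abs, abs_of_pos hb]
        linarith
      · simp only [hc0]
        linarith
  by_cases hV : s.Valid n b T J
  swap
  · rw [potential, if_neg h0, if_neg hV]
    exact le_top
  obtain ⟨⟨hy, hP⟩, ⟨hd, hrJ⟩, hy'⟩ := id hV
  by_cases h1 : s.1 = 1
  · have hq : nextQuery T s = s.2.2.1 := by rw [nextQuery, if_neg h0, if_pos h1]
    have hpot : potential n b T J s = 1 + (4 * s.2.1 + 2) := by
      rw [potential, if_neg h0, if_pos hV, if_pos h1, show (3 : ℝ≥0∞) = 1 + 2 by norm_num]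
      ring
    rw [hpot, hq]
    gcongr
    set d := b - inner ℝ n (s.2.2.1 : EuclideanSpace ℝ (Fin k)) with hd_def
    have hd0 : 0 < d := by linarith
    have hdc : ((d.toNNReal : ℝ≥0) : ℝ) = d := Real.coe_toNNReal _ hd0.le
    have hdT : d.toNNReal ≤ T s.2.1 := by rw [← NNReal.coe_le_coe, hdc]; exact hd
    set Far : Set (Ball k) := {y' : Ball k | 2 * (f d.toNNReal : ℝ) <
      ‖(y' : EuclideanSpace ℝ (Fin k)) - hyperplaneProj n b s.2.2.1‖}
    have hFar : MeasurableSet Far := measurableSet_lt (by fun_prop) (by fun_prop)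
    have hmeas : O.D s.2.2.1 Far ≤ 1 / 2 := by
      subst hℓ_def
      exact O.measure_far_le hn hy hP
    -- A near contrastive example leaves potential at most `4 r`, a far one at most `4 r + 4`; since
    -- far ones have probability at most `1/2`, the mean is at most `4 r + 2`.
    have hbound : ∀ x' ∈ oppositeLabel ℓ s.2.2.1,
        W.indicator (potential n b T J) (nextMemory J s (toObs ℓ (s.2.2.1, x'))) ≤
          4 * s.2.1 + Far.indicator (fun _ => 4) x' := by
      intro x' hx'
      have hx : b ≤ inner ℝ n (x' : EuclideanSpace ℝ (Fin k)) := by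
        by_contra h
        exact hx' ⟨fun h' => absurd ((hmem _).1 h') h,
          fun h' => absurd ((hmem _).1 h') (not_le.2 hy)⟩
      have hnext : nextMemory J s (toObs ℓ (s.2.2.1, x')) = (2, s.2.1, s.2.2.1, x') := by
        simp [nextMemory, h1, toObs]
      rw [hnext]
      set s' : Memory k := (2, s.2.1, s.2.2.1, x') with hs'
      have hV' : s'.Valid n b T J := ⟨⟨hy, hP⟩, ⟨hd, hrJ⟩, Or.inr hx⟩
      have hpot' : potential n b T J s' =
          if inner ℝ n (testPoint T s' : EuclideanSpace ℝ (Fin k)) < b then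
            1 + (4 * ((s.2.1 - 1 : ℕ) : ℝ≥0∞) + 3) else 1 + (4 * s.2.1 + 3) := by
        rw [potential, if_neg (by simp [hs']), if_pos hV', if_neg (by simp [hs'])]
      by_cases hfar : x' ∈ Far
      · rw [Set.indicator_of_mem hfar]
        refine (Set.indicator_le_self _ _ _).trans ?_
        have h4 : (4 * s.2.1 + 4 : ℝ≥0∞) = 1 + (4 * s.2.1 + 3) := by
          rw [show (4 * s.2.1 + 4 : ℝ≥0∞) = 4 * s.2.1 + (1 + 3) by norm_num]
          ring
        rw [hpot', h4]
        split_ifs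
        · gcongr
          exact Nat.sub_le _ _
        · exact le_rfl
      · have hnear : ‖(x' : EuclideanSpace ℝ (Fin k)) - hyperplaneProj n b s.2.2.1‖ ≤
            2 * (f d.toNNReal : ℝ) := not_lt.1 hfar
        rw [Set.indicator_of_notMem hfar, add_zero]
        -- At level `0` a near example already makes the hypothesis accurate; at higher levels it
        -- makes the test point cross the boundary.
        rcases Nat.eq_zero_or_pos s.2.1 with hr | hr
        · have hs'W : s' ∉ W := by
            rw [hr] at hdT
            have h2 := err_currentHyp_le hk hn (s := s') hy hP hnear
            have h3 := hT0 _ hdT (Real.toNNReal_pos.2 hd0)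
            rw [hdc] at h3
            rw [← hℓ_def] at h2
            exact not_lt.2 (h2.trans h3)
          rw [Set.indicator_of_notMem hs'W]
          exact zero_le
        · obtain ⟨r, hr'⟩ : ∃ r, s.2.1 = r + 1 := ⟨s.2.1 - 1, by lia⟩
          have hstep : inner ℝ n (testPoint T s' : EuclideanSpace ℝ (Fin k)) < b := by
            refine inner_stepToward_lt hn hy hx hnear ?_
            have h2 := hT r (by lia) d.toNNReal (by rw [← hr']; exact hdT)
            have h3 : s'.2.1 - 1 = r := by simp [hs', hr']
            rw [h3]
            exact_mod_cast h2
          refine (Set.indicator_le_self _ _ _).trans ?_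
          rw [hpot', if_pos hstep, hr']
          simp only [Nat.add_sub_cancel]
          push_cast
          rw [mul_add, mul_one, show (4 * r + 4 : ℝ≥0∞) = 4 * r + (1 + 3) by norm_num]
          apply le_of_eq
          ring
    calc _ ≤ ∫⁻ x', (4 * s.2.1 + Far.indicator (fun _ => 4) x') ∂(O.D s.2.2.1) := by
          refine lintegral_mono_ae ?_
          filter_upwards [O.label_ne s.2.2.1] with x' hx'
          exact hbound x' hx'
      _ = 4 * s.2.1 + 4 * O.D s.2.2.1 Far := by
        rw [lintegral_add_left measurable_const, lintegral_indicator_const hFar]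
        simp
      _ ≤ 4 * s.2.1 + 4 * (1 / 2) := by gcongr
      _ = 4 * s.2.1 + 2 := by
        congr 1
        rw [show (4 : ℝ≥0∞) = 2 * 2 by norm_num, one_div, mul_assoc,
          ENNReal.mul_inv_cancel (by norm_num) (by norm_num), mul_one]
  · have hq : nextQuery T s = testPoint T s := by rw [nextQuery, if_neg h0, if_neg h1]
    have hy'b : b ≤ inner ℝ n (s.2.2.2 : EuclideanSpace ℝ (Fin k)) := hy'.resolve_left h1
    by_cases hz : inner ℝ n (testPoint T s : EuclideanSpace ℝ (Fin k)) < b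
    · rw [potential, if_neg h0, if_pos hV, if_neg h1, if_pos hz]
      gcongr
      refine hconst _ fun x' _ => ?_
      have hnext : nextMemory J s (toObs ℓ (nextQuery T s, x')) =
          (1, s.2.1 - 1, testPoint T s, s.2.2.2) := by
        have : testPoint T s ∉ ℓ := fun h => absurd ((hmem _).1 h) (not_le.2 hz)
        simp [nextMemory, h0, h1, toObs, hq, this]
      rw [hnext]
      have hV' : Memory.Valid n b T J (1, s.2.1 - 1, testPoint T s, s.2.2.2) := by
        refine ⟨⟨hz, ?_⟩, ⟨sub_inner_stepToward_le hn (NNReal.coe_nonneg _) hy'b,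
          (Nat.sub_le _ _).trans hrJ⟩, Or.inl rfl⟩
        -- For `b ≤ 0` every point outside the half-space projects into the ball. For `b > 0` every
        -- point inside it does, in particular `y'`, and convexity covers the segment from `y'` to
        -- `y`.
        by_cases hb : b ≤ 0
        · exact norm_hyperplaneProj_le_half hn _ (by nlinarith)
        · refine norm_hyperplaneProj_stepToward_le (NNReal.coe_nonneg _) hP
            (norm_hyperplaneProj_le_half hn _ (by nlinarith))
      rw [potential, if_neg one_ne_zero, if_pos hV', if_pos rfl]
    · rw [potential, if_neg h0, if_pos hV, if_neg h1, if_neg hz]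
      gcongr
      refine hconst _ fun x' _ => ?_
      have hnext : nextMemory J s (toObs ℓ (nextQuery T s, x')) = (1, s.2) := by
        have : testPoint T s ∈ ℓ := (hmem _).2 (not_lt.1 hz)
        simp [nextMemory, h0, h1, toObs, hq, this]
      rw [hnext]
      have hV' : Memory.Valid n b T J (1, s.2) := ⟨⟨hy, hP⟩, ⟨hd, hrJ⟩, Or.inl rfl⟩
      rw [potential, if_neg one_ne_zero, if_pos hV', if_pos rfl]

/-- The expected sample requirement is at most linear in the number of levels. -/
theorem expectedSampleRequirement_halfSpaces_le (hk : 1 ≤ k) {f : ℝ≥0 → ℝ≥0} {ε : ℝ}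
    {T : ℕ → ℝ≥0} {J : ℕ} (hTJ : 1 / 2 ≤ T J) (hT : ∀ r < J, ∀ d ≤ T (r + 1), 2 * f d < T r)
    (hT0 : ∀ d ≤ T 0, 0 < d → 2 ^ (k - 1) * (2 * (2 * (f d : ℝ) / d)) ≤ ε) :
    expectedSampleRequirement (uniformBall k) (halfSpaces k) (measurableSet_of_mem_halfSpaces k)
      f ε ≤ 4 * J + 4 := by
  refine iInf_le_of_le (levelLearner k T J) (iSup_le fun ⟨ℓ, hℓ⟩ => iSup_le fun O => ?_)
  obtain ⟨y, hy⟩ := O.exists_mem_oppositeLabel (ballCenter k)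
  obtain ⟨n, b, hn, rfl⟩ := exists_unit_normal hℓ hy
  refine (lintegral_firstAccurate_automatonLearner_le hℓ _ O.D ε (measurable_potential n b T J)
    (potential_drift hk hn rfl O hTJ hT hT0)).trans ?_
  simp [potential]

end Learner

/-! ### Choice of the target distances. -/

/-- The growth condition on `f` cancels the factor `4 / d` of the error bound and leaves `2^(k-1) *
d ^ c`; this is where `ε'` comes from. -/
theorem accurate_of_le {f : ℝ≥0 → ℝ≥0} {c : ℝ} (hc : 0 < c) (hfc : ∀ x, f x ≤ x ^ (1 + c) / 4)
    (k : ℕ) {ε d : ℝ≥0} (hd : d ≤ (ε / 2 ^ (k - 1)) ^ (1 / c)) (hd0 : 0 < d) :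
    2 ^ (k - 1) * (2 * (2 * (f d : ℝ) / d)) ≤ ε := by
  have h1 : d ^ c ≤ ε / 2 ^ (k - 1) := by
    calc d ^ c ≤ ((ε / 2 ^ (k - 1)) ^ (1 / c)) ^ c := NNReal.rpow_le_rpow hd hc.le
      _ = _ := by rw [← NNReal.rpow_mul, one_div_mul_cancel hc.ne', NNReal.rpow_one]
  have h2 : 4 * f d ≤ d * d ^ c := by
    have := hfc d
    rw [NNReal.rpow_add hd0.ne', NNReal.rpow_one, le_div_iff₀ (by norm_num)] at this
    rwa [mul_comm]
  have h3 : 4 * f d / d ≤ d ^ c := by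
    rw [div_le_iff₀ hd0, mul_comm (d ^ c)]
    exact h2
  have h4 : 2 ^ (k - 1) * (4 * f d / d) ≤ ε := by
    calc _ ≤ 2 ^ (k - 1) * (ε / 2 ^ (k - 1)) := mul_le_mul' le_rfl (h3.trans h1)
      _ = ε := mul_div_cancel₀ _ (by positivity)
  have h5 : (2 : ℝ) ^ (k - 1) * (4 * (f d : ℝ) / d) ≤ ε := by exact_mod_cast h4
  calc _ = (2 : ℝ) ^ (k - 1) * (4 * (f d : ℝ) / d) := by ring
    _ ≤ _ := h5

end

end Contrastive

theorem theorem9 (k : ℕ) (hk : 1 ≤ k) (c : ℝ) (hc : 0 < c) (f : ℝ≥0 → ℝ≥0) (hf : Monotone f)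
    (hfc : ∀ x, f x ≤ x ^ (1 + c) / 4) (ε : ℝ≥0) (hε0 : 0 < ε) (hε1 : ε ≤ 1) :
    Contrastive.expectedSampleRequirement (Contrastive.uniformBall k) (Contrastive.halfSpaces k)
        (Contrastive.measurableSet_of_mem_halfSpaces k) f ε ≤
      8 * (Contrastive.iterationsUntil (fun x => 3 * f (2 * x)) (1 / 2)
        ((ε / 2 ^ (k - 1)) ^ (1 / c)) : ℝ≥0∞) + 8 := by
  classical
  set g : ℝ≥0 → ℝ≥0 := fun x => 3 * f (2 * x) with hg
  set δ : ℝ≥0 := (ε / 2 ^ (k - 1)) ^ (1 / c) with hδ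
  have hδ0 : 0 < δ := NNReal.rpow_pos (by positivity)
  by_cases h : ∃ m, g^[m] (1 / 2) ≤ δ
  · set J := Nat.find h with hJ
    have hJle : (J : ℕ∞) ≤ Contrastive.iterationsUntil g (1 / 2) δ :=
      le_iInf₂ fun m hm => by exact_mod_cast Nat.find_min' h hm
    -- With `r` levels left, the target is the iterate number `J - r`. The maximum with `δ` makes
    -- the final target exactly `δ` and keeps all targets positive.
    set T : ℕ → ℝ≥0 := fun r => max (g^[J - r] (1 / 2)) δ with hT
    have hT0 : T 0 = δ := max_eq_right (Nat.find_spec h)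
    have hTJ : (1 / 2 : ℝ) ≤ T J := by
      have : (1 / 2 : ℝ≥0) ≤ T J := by simp [hT]
      exact_mod_cast this
    have hstep : ∀ r < J, ∀ d ≤ T (r + 1), 2 * f d < T r := by
      intro r hr d hd
      have h1 : δ < g^[J - (r + 1)] (1 / 2) := not_le.1 (Nat.find_min h (by lia))
      have h2 : T (r + 1) = g^[J - (r + 1)] (1 / 2) := max_eq_left h1.le
      have h3 : 3 * f (2 * T (r + 1)) ≤ T r := by
        rw [h2]
        refine le_trans (le_of_eq ?_) (le_max_left _ _)
        rw [show J - r = (J - (r + 1)) + 1 by lia, Function.iterate_succ_apply']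
      have h4 : f d ≤ f (2 * T (r + 1)) := hf (hd.trans (by rw [two_mul]; exact le_self_add))
      -- Crossing needs a strict inequality: the factor `3` in place of `2` supplies it when `f d >
      -- 0`, and positivity of `δ` when `f d = 0`.
      rcases eq_or_ne (f d) 0 with h0 | h0
      · rw [h0, mul_zero]
        exact hδ0.trans_le (le_max_right _ _)
      · calc 2 * f d < 3 * f d := by
              have : 0 < f d := pos_iff_ne_zero.2 h0
              gcongr
              norm_num
          _ ≤ 3 * f (2 * T (r + 1)) := by gcongr
          _ ≤ T r := h3
    refine (Contrastive.expectedSampleRequirement_halfSpaces_le hk hTJ hstep fun d hd hd0 =>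
      Contrastive.accurate_of_le hc hfc k (hd.trans hT0.le) hd0).trans ?_
    have hJ' : (J : ℝ≥0∞) ≤ (Contrastive.iterationsUntil g (1 / 2) δ : ℝ≥0∞) := by
      exact_mod_cast hJle
    gcongr <;> norm_num
  · push Not at h
    have htop : Contrastive.iterationsUntil g (1 / 2) δ = ⊤ := by
      simp only [Contrastive.iterationsUntil, iInf_eq_top]
      exact fun m hm => absurd hm (not_le.2 (h m))
    rw [htop]
    simp
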